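/- Let $H$ be a real separable Hilbert space with a complete orthonormal system $(e_j)_j$, let $n,m\ge 1$, and let $f\in H^{\otimes n}$, $g\in H^{\otimes m}$ be symmetric elements of the Hilbert tensor powers, with coefficients $\lambda_{j_1,\dots,j_n}=\langle f,e_{j_1}\otimes\cdots\otimes e_{j_n}\rangle$ and $\beta_{k_1,\dots,k_m}=\langle g,e_{k_1}\otimes\cdots\otimes e_{k_m}\rangle$. For $0\le r\le n\wedge m$ define the contraction $$f\otimes_r g=\sum_{j_1,\dots,j_{n-r}}\ \sum_{k_1,\dots,k_{m-r}}\Big(\sum_{i_1,\dots,i_r}\lambda_{i_1,\dots,i_r,j_1,\dots,j_{n-r}}\,\beta_{i_1,\dots,i_r,k_1,\dots,k_{m-r}}\Big)\,e_{j_1}\otimes\cdots\otimes e_{j_{n-r}}\otimes e_{k_1}\otimes\cdots\otimes e_{k_{m-r}}\in H^{\otimes(n+m-2r)},$$ and let $f\,\tilde\otimes_r\, g$ be its symmetrization. Put $$s_{i,f}=n\sum_{j_2,\dots,j_n}\lambda_{i,j_2,\dots,j_n}\,e_{j_2}\otimes\cdots\otimes e_{j_n},\qquad s_{l,g}=m\sum_{k_2,\dots,k_m}\beta_{l,k_2,\dots,k_m}\,e_{k_2}\otimes\cdots\otimes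 e_{k_m},$$ and, for $0\le k\le (n-1)\wedge(m-1)$, with $C_a^b=\binom ab$, $$T_k=\frac12\sum_{i,l}k!^2\,(C_{m-1}^k)^2(C_{n-1}^k)^2\,(m+n-2-2k)!\,\big\|s_{i,f}\tilde\otimes_k s_{l,g}-s_{l,f}\tilde\otimes_k s_{i,g}\big\|^2 .$$ ($T_k$ is the term of order $k$ in the chaos expansion of $E\det\Lambda$, where $\Lambda$ is the Malliavin matrix of the pair of multiple Wiener-Itô integrals $(I_n(f),I_m(g))$.) Then the series defining $T_0$ converges and $$T_0=\sum_{r=0}^{(n-1)\wedge(m-1)} mn\,m!\,n!\,C_{n-1}^r\,C_{m-1}^r\left[\|f\otimes_r g\|^2-\|f\otimes_{r+1}g\|^2\right].$$ Consequently, $$\sum_{r=0}^{(n-1)\wedge(m-1)} C_{n-1}^r\,C_{m-1}^r\left[\|f\otimes_r g\|^2-\|f\otimes_{r+1}g\|^2\right]\ge 0 .$$ -/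

import Mathlib

open scoped TensorProduct

noncomputable section

namespace WienerChaos

universe u v

/-- A real Hilbert space, bundled with its structure. -/
structure RealHilbert : Type (u + 1) where
  carrier : Type u
  [normedGroup : NormedAddCommGroup carrier]
  [innerSpace : InnerProductSpace ℝ carrier]
  [complete : CompleteSpace carrier]

attribute [instance] RealHilbert.normedGroup RealHilbert.innerSpace RealHilbert.complete

/-- The Hilbert tensor powers of `H`, by recursion: the zeroth power is the one-dimensional
space of scalars (taken in the universe of `H`), and the next power is the completion of the
algebraic tensor product of `H` with the previous power for the inner product
`⟪a ⊗ b, a' ⊗ b'⟫ = ⟪a, a'⟫ ⟪b, b'⟫`. -/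
def tensorPowBundled (H : Type u) [NormedAddCommGroup H] [InnerProductSpace ℝ H] :
    ℕ → RealHilbert.{u}
  | 0 => ⟨EuclideanSpace ℝ PUnit.{u + 1}⟩
  | n + 1 => ⟨UniformSpace.Completion (H ⊗[ℝ] (tensorPowBundled H n).carrier)⟩

section

variable (H : Type u) [NormedAddCommGroup H] [InnerProductSpace ℝ H]

/-- The Hilbert space `H^{⊗ n}`. -/
def TensorPow (n : ℕ) : Type u := (tensorPowBundled H n).carrier

instance (n : ℕ) : NormedAddCommGroup (TensorPow H n) :=
  (tensorPowBundled H n).normedGroup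

instance (n : ℕ) : InnerProductSpace ℝ (TensorPow H n) :=
  (tensorPowBundled H n).innerSpace

instance (n : ℕ) : CompleteSpace (TensorPow H n) :=
  (tensorPowBundled H n).complete

end

section

variable {H : Type u} [NormedAddCommGroup H] [InnerProductSpace ℝ H]

/-- The elementary tensor `h 0 ⊗ h 1 ⊗ ⋯ ⊗ h (n - 1)` in `H^{⊗ n}`; for `n = 0` it is the
unit scalar. -/
def tprod : (n : ℕ) → (Fin n → H) → TensorPow H n
  | 0, _ => (EuclideanSpace.single PUnit.unit (1 : ℝ) : EuclideanSpace ℝ PUnit.{u + 1})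
  | n + 1, h =>
      ((h 0 ⊗ₜ[ℝ] (tprod n (Fin.tail h)) : H ⊗[ℝ] (tensorPowBundled H n).carrier) :
        UniformSpace.Completion (H ⊗[ℝ] (tensorPowBundled H n).carrier))

variable {ι : Type v} (e : HilbertBasis ι ℝ H)

/-- The elementary tensor `e_{j 0} ⊗ ⋯ ⊗ e_{j (n - 1)}` of basis vectors. -/
def basisTensor {n : ℕ} (j : Fin n → ι) : TensorPow H n :=
  tprod n (fun a => e (j a))

/-- The coefficient `⟪f, e_{j 0} ⊗ ⋯ ⊗ e_{j (n - 1)}⟫` of `f` in the orthonormal basis of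
elementary tensors. -/
def coeff {n : ℕ} (f : TensorPow H n) (j : Fin n → ι) : ℝ :=
  inner ℝ f (basisTensor e j)

/-- `f` is symmetric: its coefficients are invariant under permutations of the indices. -/
def IsSymmetric {n : ℕ} (f : TensorPow H n) : Prop :=
  ∀ (σ : Equiv.Perm (Fin n)) (j : Fin n → ι), coeff e f (j ∘ σ) = coeff e f j

/-- Symmetrization: the average over all permutations of the indices. -/
def symmetrize {n : ℕ} (f : TensorPow H n) : TensorPow H n :=
  ∑' j : Fin n → ι,
    ((n.factorial : ℝ)⁻¹ * ∑ σ : Equiv.Perm (Fin n), coeff e f (j ∘ σ)) • basisTensor e j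

/-- The multi-index `(i_1, …, i_r, j_1, …, j_{n-r})` of length `n`, meant for `r ≤ n`. -/
def glue {n r : ℕ} (i : Fin r → ι) (j : Fin (n - r) → ι) : Fin n → ι :=
  fun a => if h : (a : ℕ) < r then i ⟨a, h⟩ else j ⟨a - r, by omega⟩

/-- The contraction `f ⊗_r g` of order `r ≤ min n m`, with values in `H^{⊗ (n + m - 2 r)}`:
its coefficient at `(j, k)` is `∑_i λ_{i, j} β_{i, k}`, where `λ`, `β` are the coefficients
of `f`, `g`. -/
def contraction {n m : ℕ} (r : ℕ) (f : TensorPow H n) (g : TensorPow H m) :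
    TensorPow H ((n - r) + (m - r)) :=
  ∑' p : (Fin (n - r) → ι) × (Fin (m - r) → ι),
    (∑' i : Fin r → ι, coeff e f (glue i p.1) * coeff e g (glue i p.2)) •
      basisTensor e (Fin.append p.1 p.2)

/-- The symmetrized contraction. -/
def symContraction {n m : ℕ} (r : ℕ) (f : TensorPow H n) (g : TensorPow H m) :
    TensorPow H ((n - r) + (m - r)) :=
  symmetrize e (contraction e r f g)

/-- The slice `s_{i,f} = n ∑_{j_2, …, j_n} λ_{i, j_2, …, j_n} e_{j_2} ⊗ ⋯ ⊗ e_{j_n}`. -/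
def slice {n : ℕ} (f : TensorPow H n) (i : ι) : TensorPow H (n - 1) :=
  (n : ℝ) • ∑' j : Fin (n - 1) → ι,
    coeff e f (glue (fun _ : Fin 1 => i) j) • basisTensor e j

/-- The `(i, l)` summand of the term of order `k` in the expansion of `E det Λ`. -/
def chaosSummand {n m : ℕ} (f : TensorPow H n) (g : TensorPow H m) (k : ℕ) (i l : ι) : ℝ :=
  (k.factorial : ℝ) ^ 2 * ((m - 1).choose k : ℝ) ^ 2 * ((n - 1).choose k : ℝ) ^ 2 *
    ((m + n - 2 - 2 * k).factorial : ℝ) *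
    ‖symContraction e k (slice e f i) (slice e g l) -
      symContraction e k (slice e f l) (slice e g i)‖ ^ 2

/-- The term `T_k`, for `k ≤ min (n - 1) (m - 1)`. -/
def chaosTerm {n m : ℕ} (f : TensorPow H n) (g : TensorPow H m) (k : ℕ) : ℝ :=
  (1 / 2) * ∑' p : ι × ι, chaosSummand e f g k p.1 p.2

end

end WienerChaos

end

/-!
Everything is expressed through the coefficients `λ` of `f` and `β` of `g`, which are
square-summable because the tensors of basis vectors are orthonormal (`orthonormal_basisTensor`,
`inner_tsum_smul_of_orthonormal`). Let `G(J) = λ(J_left) β(J_right)` on index functions `J` of the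
disjoint union of `n` and `m` positions (`tensorFamily`), and for a permutation `π` of the positions
let `corr G π = ∑_J G(J ∘ π) G(J)`.

Since `λ` and `β` are symmetric, `corr G π` only depends on the double coset of `π` modulo the
permutations preserving the two blocks, that is, on the number `r` of positions which `π` moves from
the left block to the right one (`crossings`, `exists_perm_of_crossings_eq`). Evaluating at the
permutation exchanging the first `r` positions of the two blocks, Fubini gives
`corr G π = ‖f ⊗_r g‖²` (`hasSum_contraction_sq`, `norm_contraction_sq_eq_corr`).

In `T_0`, the indices `i`, `l` of the two slices occupy one distinguished position in each block, and
the symmetrizations average over the permutations `σ` of the remaining positions. Expanding the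
squared norm of the antisymmetrization in `i`, `l` yields, up to constants, the sum over `σ` of
`corr G (1 ⊕ σ) - corr G (swap ⊕ σ)` (`hasSum_sq_sum_perm_antisymm`), where `swap` exchanges the
distinguished positions. If `σ` has `r` crossings, then `1 ⊕ σ` has `r` and `swap ⊕ σ` has `r + 1`
(`crossings_headsEquiv`), so the summand is `‖f ⊗_r g‖² - ‖f ⊗_{r+1} g‖²`. Finally there are
`(n-1)! (m-1)! C(n-1,r) C(m-1,r)` permutations `σ` with `r` crossings (`sum_perm_crossings`). The
inequality holds because `T_0` is a sum of squares.
-/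

open scoped TensorProduct

noncomputable section

namespace WienerChaos

universe u v

/-! ### Orthonormal families and coefficients of tensors -/

section Orthonormal

variable {E : Type*} [NormedAddCommGroup E] [InnerProductSpace ℝ E] {κ : Type*} {v : κ → E}

theorem summable_smul_of_orthonormal [CompleteSpace E] (hv : Orthonormal ℝ v) {c : κ → ℝ}
    (hc : Summable fun i => c i ^ 2) : Summable fun i => c i • v i := by
  have := (hv.orthogonalFamily.summable_iff_norm_sq_summable c).2 (by simpa using hc)
  simpa [LinearIsometry.toSpanSingleton_apply] using this

theorem inner_tsum_smul_of_orthonormal [CompleteSpace E] (hv : Orthonormal ℝ v) {c : κ → ℝ}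
    (hc : Summable fun i => c i ^ 2) :
    (∀ i, inner ℝ (∑' i, c i • v i) (v i) = c i) ∧
      HasSum (fun i => c i ^ 2) (‖∑' i, c i • v i‖ ^ 2) := by
  obtain ⟨x, hx⟩ := summable_smul_of_orthonormal hv hc
  rw [hx.tsum_eq]
  have key : ∀ i, inner ℝ x (v i) = c i := by
    intro i
    have h1 := hx.mapL (innerSL ℝ (v i))
    simp only [innerSL_apply_apply, inner_smul_right] at h1
    have h2 := hasSum_single (f := fun b => c b * inner ℝ (v i) (v b)) i
      (fun b hb => by rw [hv.2 hb.symm, mul_zero])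
    rw [real_inner_comm, h1.unique h2, real_inner_self_eq_norm_sq, hv.1 i]
    simp
  refine ⟨key, ?_⟩
  have h1 := hx.mapL (innerSL ℝ x)
  simp only [innerSL_apply_apply, inner_smul_right, key, real_inner_self_eq_norm_sq] at h1
  simpa [pow_two] using h1

end Orthonormal

section Coefficients

variable {H : Type u} [NormedAddCommGroup H] [InnerProductSpace ℝ H]

theorem inner_tprod_tprod : ∀ (n : ℕ) (h h' : Fin n → H),
    inner ℝ (tprod n h) (tprod n h') = ∏ a, inner ℝ (h a) (h' a)
  | 0, h, h' => by
      change inner ℝ (EuclideanSpace.single PUnit.unit (1 : ℝ) : EuclideanSpace ℝ PUnit.{u + 1})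
        (EuclideanSpace.single PUnit.unit (1 : ℝ)) = _
      simp
  | n + 1, h, h' => by
      rw [Fin.prod_univ_succ]
      refine (UniformSpace.Completion.inner_coe _ _).trans ?_
      refine (TensorProduct.inner_tmul _ _ _ _ _).trans ?_
      exact congrArg _ (inner_tprod_tprod n _ _)

variable {ι : Type v} (e : HilbertBasis ι ℝ H)

theorem orthonormal_basisTensor (n : ℕ) :
    Orthonormal ℝ (fun j : Fin n → ι => basisTensor e j) := by
  classical
  rw [orthonormal_iff_ite]
  intro j k
  rw [basisTensor, basisTensor, inner_tprod_tprod]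
  simp only [orthonormal_iff_ite.1 e.orthonormal]
  rw [Finset.prod_ite_zero]
  simp [funext_iff]

theorem summable_coeff_sq {n : ℕ} (f : TensorPow H n) :
    Summable fun j => coeff e f j ^ 2 := by
  have := (orthonormal_basisTensor e n).inner_products_summable f
  simpa [coeff, real_inner_comm] using this

theorem coeff_tsum_smul_basisTensor {n : ℕ} {c : (Fin n → ι) → ℝ}
    (hc : Summable fun j => c j ^ 2) (j : Fin n → ι) :
    coeff e (∑' j, c j • basisTensor e j) j = c j :=
  (inner_tsum_smul_of_orthonormal (orthonormal_basisTensor e n) hc).1 j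

theorem glue_injective {n r : ℕ} (hr : r ≤ n) :
    Function.Injective fun p : (Fin r → ι) × (Fin (n - r) → ι) => glue p.1 p.2 := by
  rintro ⟨i, j⟩ ⟨i', j'⟩ h
  simp only [Prod.mk.injEq]
  constructor
  · funext a
    have := congrFun h ⟨a, by omega⟩
    simpa [glue] using this
  · funext a
    have := congrFun h ⟨a + r, by omega⟩
    simpa [glue] using this

theorem append_injective {n m : ℕ} :
    Function.Injective fun p : (Fin n → ι) × (Fin m → ι) => Fin.append p.1 p.2 := by
  rintro ⟨i, j⟩ ⟨i', j'⟩ h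
  simp only [Prod.mk.injEq]
  constructor
  · funext a
    simpa using congrFun h (Fin.castAdd _ a)
  · funext a
    simpa using congrFun h (Fin.natAdd _ a)

/-- Contractions are defined by a possibly divergent series; as soon as their coefficients are
square-summable, the norm is the one expected. -/
theorem hasSum_norm_contraction_sq {n m r : ℕ} (f : TensorPow H n) (g : TensorPow H m)
    (hs : Summable fun p : (Fin (n - r) → ι) × (Fin (m - r) → ι) =>
      (∑' i : Fin r → ι, coeff e f (glue i p.1) * coeff e g (glue i p.2)) ^ 2) :
    HasSum (fun p : (Fin (n - r) → ι) × (Fin (m - r) → ι) =>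
      (∑' i : Fin r → ι, coeff e f (glue i p.1) * coeff e g (glue i p.2)) ^ 2)
      (‖contraction e r f g‖ ^ 2) :=
  (inner_tsum_smul_of_orthonormal
    ((orthonormal_basisTensor e ((n - r) + (m - r))).comp _ append_injective) hs).2

theorem coeff_slice {n : ℕ} (f : TensorPow H (n + 1)) (i : ι) (j : Fin n → ι) :
    coeff e (n := n) (slice e f i) j = (n + 1) * coeff e f (Fin.cons i j) := by
  have hg : ∀ j : Fin n → ι,
      (glue (n := n + 1) (fun _ : Fin 1 => i) j : Fin (n + 1) → ι) = Fin.cons i j := by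
    intro j
    funext a
    refine Fin.cases ?_ (fun a => ?_) a <;> simp [glue]
  have hc : Summable fun j : Fin n → ι => coeff e f (Fin.cons i j) ^ 2 :=
    (summable_coeff_sq e f).comp_injective (Fin.cons_right_injective (α := fun _ => ι) i)
  have h := coeff_tsum_smul_basisTensor e hc j
  rw [coeff] at h ⊢
  rw [← h, slice]
  push_cast
  rw [real_inner_smul_left]
  simp only [hg]
  rfl

theorem coeff_contraction_zero {n m : ℕ} (u : TensorPow H n) (w : TensorPow H m)
    (j : Fin (n + m) → ι) :
    coeff e (n := n + m) (contraction e 0 u w) j =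
      coeff e u (j ∘ Fin.castAdd m) * coeff e w (j ∘ Fin.natAdd n) := by
  have hg : ∀ {k : ℕ} (i : Fin 0 → ι) (j : Fin k → ι), glue (n := k) i j = j := by
    intro k i j
    funext a
    simp [glue]
  have hsum : Summable fun p : (Fin n → ι) × (Fin m → ι) =>
      (coeff e u p.1 * coeff e w p.2) ^ 2 := by
    simp only [mul_pow]
    exact (summable_coeff_sq e u).mul_of_nonneg (summable_coeff_sq e w)
      (fun _ => sq_nonneg _) (fun _ => sq_nonneg _)
  have h := (inner_tsum_smul_of_orthonormal
    ((orthonormal_basisTensor e (n + m)).comp _ append_injective) hsum).1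
      (j ∘ Fin.castAdd m, j ∘ Fin.natAdd n)
  have ha : Fin.append (j ∘ Fin.castAdd m) (j ∘ Fin.natAdd n) = j :=
    Fin.append_castAdd_natAdd
  simp only [Function.comp_apply, ha] at h
  rw [← h, coeff, contraction]
  refine congrArg (fun x => inner ℝ x (basisTensor e j)) (tsum_congr fun p => ?_)
  rw [tsum_fintype, Fintype.sum_unique]
  simp only [Nat.sub_zero] at *
  rw [hg, hg]

theorem summable_sum_sq {κ σ : Type*} [Fintype σ] {F : σ → κ → ℝ}
    (hF : ∀ s, Summable fun x => F s x ^ 2) : Summable fun x => (∑ s, F s x) ^ 2 :=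
  ((summable_sum fun s (_ : s ∈ Finset.univ) => hF s).mul_left
    ((Finset.univ : Finset σ).card : ℝ)).of_nonneg_of_le (fun _ => sq_nonneg _)
      (fun _ => sq_sum_le_card_mul_sum_sq)

theorem hasSum_norm_symmetrize_sub_sq {n : ℕ} (u w : TensorPow H n) :
    HasSum (fun j : Fin n → ι => ((n.factorial : ℝ)⁻¹ *
        ∑ σ : Equiv.Perm (Fin n), (coeff e u (j ∘ σ) - coeff e w (j ∘ σ))) ^ 2)
      (‖symmetrize e u - symmetrize e w‖ ^ 2) := by
  have hs : ∀ u : TensorPow H n, Summable fun j : Fin n → ι => ((n.factorial : ℝ)⁻¹ *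
      ∑ σ : Equiv.Perm (Fin n), coeff e u (j ∘ σ)) ^ 2 := by
    intro u
    simp only [mul_pow]
    exact (summable_sum_sq fun σ : Equiv.Perm (Fin n) =>
      (summable_coeff_sq e u).comp_injective
        (σ.surjective.injective_comp_right (γ := ι))).mul_left _
  have hd : Summable fun j : Fin n → ι => ((n.factorial : ℝ)⁻¹ *
      ∑ σ : Equiv.Perm (Fin n), (coeff e u (j ∘ σ) - coeff e w (j ∘ σ))) ^ 2 := by
    refine (((hs u).add (hs w)).mul_left 2).of_nonneg_of_le (fun _ => sq_nonneg _) fun j => ?_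
    rw [Finset.sum_sub_distrib, mul_sub]
    nlinarith [sq_nonneg ((n.factorial : ℝ)⁻¹ * ∑ σ : Equiv.Perm (Fin n), coeff e u (j ∘ σ) +
      (n.factorial : ℝ)⁻¹ * ∑ σ : Equiv.Perm (Fin n), coeff e w (j ∘ σ))]
  have hv := orthonormal_basisTensor e n
  have heq : symmetrize e u - symmetrize e w = ∑' j : Fin n → ι, ((n.factorial : ℝ)⁻¹ *
      ∑ σ : Equiv.Perm (Fin n), (coeff e u (j ∘ σ) - coeff e w (j ∘ σ))) • basisTensor e j := by
    rw [symmetrize, symmetrize, ← (summable_smul_of_orthonormal hv (hs u)).tsum_sub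
      (summable_smul_of_orthonormal hv (hs w))]
    refine tsum_congr fun j => ?_
    rw [← sub_smul, ← mul_sub, ← Finset.sum_sub_distrib]
  rw [heq]
  exact (inner_tsum_smul_of_orthonormal hv hd).2

/-- The summands of `chaosTerm e f g 0` in terms of the coefficients of `f` and `g`. -/
theorem hasSum_chaosSummand_zero {n m : ℕ} (f : TensorPow H (n + 1)) (g : TensorPow H (m + 1))
    (i l : ι) :
    HasSum (fun j : Fin (n + m) → ι =>
      ((n + 1 : ℝ) * (m + 1)) ^ 2 * ((n + m).factorial : ℝ)⁻¹ *
      (∑ σ : Equiv.Perm (Fin (n + m)),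
        (coeff e f (Fin.cons i ((j ∘ σ) ∘ Fin.castAdd m)) *
            coeff e g (Fin.cons l ((j ∘ σ) ∘ Fin.natAdd n)) -
          coeff e f (Fin.cons l ((j ∘ σ) ∘ Fin.castAdd m)) *
            coeff e g (Fin.cons i ((j ∘ σ) ∘ Fin.natAdd n)))) ^ 2)
      (chaosSummand e f g 0 i l) := by
  have hN : ((n + m).factorial : ℝ) ≠ 0 := by positivity
  have h := (hasSum_norm_symmetrize_sub_sq e (n := n + m)
    (contraction e (n := n) (m := m) 0 (slice e f i) (slice e g l))
    (contraction e (n := n) (m := m) 0 (slice e f l) (slice e g i))).mul_left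
      ((n + m).factorial : ℝ)
  simp only [coeff_contraction_zero, coeff_slice] at h
  have h2 : chaosSummand e f g 0 i l = ((n + m).factorial : ℝ) *
      ‖symmetrize e (n := n + m)
        (contraction e (n := n) (m := m) 0 (slice e f i) (slice e g l)) -
      symmetrize e (n := n + m)
        (contraction e (n := n) (m := m) 0 (slice e f l) (slice e g i))‖ ^ 2 := by
    have : m + 1 + (n + 1) - 2 - 2 * 0 = n + m := by omega
    rw [chaosSummand, this]
    simp only [Nat.factorial_zero, Nat.choose_zero_right, Nat.cast_one, one_pow, one_mul]
    rfl
  rw [h2]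
  refine h.congr_fun fun j => ?_
  have hfac : ∀ A B C D : ℝ, (n + 1 : ℝ) * A * ((m + 1) * B) - (n + 1) * C * ((m + 1) * D) =
      (n + 1) * (m + 1) * (A * B - C * D) := by
    intros
    ring
  rw [Finset.sum_congr rfl fun _ _ => hfac _ _ _ _, ← Finset.mul_sum]
  field_simp

end Coefficients

/-! ### Crossing numbers of permutations -/

section Crossings

open Finset

variable {X : Type*} [Fintype X]

/-- The number of points of the side `s = false` which the permutation `π` moves to the side
`s = true`. -/
def crossings (s : X → Bool) (π : Equiv.Perm X) : ℕ :=
  #{x | s x = false ∧ s (π x) = true}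

theorem crossings_permCongr {Y : Type*} [Fintype Y] (Ψ : Y ≃ X) (s : X → Bool)
    (π : Equiv.Perm Y) : crossings s (Ψ.permCongr π) = crossings (s ∘ Ψ) π := by
  rw [crossings, crossings]
  exact card_equiv Ψ.symm fun x => by rw [mem_filter, mem_filter]; simp

theorem crossings_sumCongr {Y : Type*} [Fintype Y] (s : X ⊕ Y → Bool) (π : Equiv.Perm X)
    (ρ : Equiv.Perm Y) : crossings s (Equiv.sumCongr π ρ) =
      crossings (s ∘ Sum.inl) π + crossings (s ∘ Sum.inr) ρ := by
  simp only [crossings, card_filter, Fintype.sum_sum_type]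
  rfl

theorem card_filter_side_perm (s : X → Bool) (π : Equiv.Perm X) (b : Bool) :
    #{x | s (π x) = b} = #{x | s x = b} :=
  card_equiv π (by simp)

theorem crossings_le_card_left (s : X → Bool) (π : Equiv.Perm X) :
    crossings s π ≤ #{x | s x = false} :=
  card_le_card (monotone_filter_right _ fun _ _ h => h.1)

theorem crossings_le_card_right (s : X → Bool) (π : Equiv.Perm X) :
    crossings s π ≤ #{x | s x = true} := by
  rw [← card_filter_side_perm s π]
  exact card_le_card (monotone_filter_right _ fun _ _ h => h.2)

/-- Permutations with the same crossing number lie in the same double coset of the group of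
permutations preserving the sides: the pair of sides of `x` and `π x` takes each of its four
values equally often for both. -/
theorem exists_perm_of_crossings_eq (s : X → Bool) {π π' : Equiv.Perm X}
    (h : crossings s π = crossings s π') :
    ∃ ρ δ : Equiv.Perm X, (∀ x, s (ρ x) = s x) ∧ (∀ x, s (δ x) = s x) ∧ π' = δ * π * ρ⁻¹ := by
  have hcard : ∀ c : Bool × Bool, #{x | (s x, s (π x)) = c} = #{x | (s x, s (π' x)) = c} := by
    -- each of the four counts is determined by the crossing number and the sizes of the sides
    have hrow : ∀ (τ : Equiv.Perm X) (b : Bool),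
        #{x | (s x, s (τ x)) = (b, true)} + #{x | (s x, s (τ x)) = (b, false)} =
          #{x | s x = b} := by
      intro τ b
      rw [← card_filter_add_card_filter_not (s := ({x | s x = b} : Finset X))
        (fun x => s (τ x) = true), filter_filter, filter_filter]
      simp
    have hcol : ∀ (τ : Equiv.Perm X) (b : Bool),
        #{x | (s x, s (τ x)) = (true, b)} + #{x | (s x, s (τ x)) = (false, b)} =
          #{x | s x = b} := by
      intro τ b
      rw [← card_filter_side_perm s τ b,
        ← card_filter_add_card_filter_not (s := ({x | s (τ x) = b} : Finset X))
        (fun x => s x = true), filter_filter, filter_filter]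
      simp [and_comm]
    have hft : #{x | (s x, s (π x)) = (false, true)} =
        #{x | (s x, s (π' x)) = (false, true)} := by
      simpa [crossings] using h
    have h1 := hrow π false
    have h2 := hrow π' false
    have h3 := hcol π true
    have h4 := hcol π' true
    have h5 := hcol π false
    have h6 := hcol π' false
    rintro ⟨_ | _, _ | _⟩ <;> omega
  have hequiv : ∀ c, Nonempty ({x // (s x, s (π x)) = c} ≃ {x // (s x, s (π' x)) = c}) := by
    intro c
    rw [← Fintype.card_eq, Fintype.card_subtype, Fintype.card_subtype]
    exact hcard c
  have E := fun c => (hequiv c).some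
  let ρ : Equiv.Perm X := Equiv.ofFiberEquiv (f := fun x => (s x, s (π x)))
    (g := fun x => (s x, s (π' x))) fun c => E c
  have hρ : ∀ x, (s (ρ x), s (π' (ρ x))) = (s x, s (π x)) :=
    fun x => Equiv.ofFiberEquiv_map (f := fun x => (s x, s (π x)))
      (g := fun x => (s x, s (π' x))) (fun c => E c) x
  refine ⟨ρ, π' * ρ * π⁻¹, fun x => congrArg Prod.fst (hρ x), fun x => ?_, by group⟩
  have := congrArg Prod.snd (hρ (π⁻¹ x))
  simpa using this

variable [DecidableEq X]

/-- The permutations with a given image of the side `s = false` are equidistributed over the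
sets of the right size. -/
theorem sum_perm_map_eq (L : Finset X) (F : Finset X → ℝ) :
    ∑ σ : Equiv.Perm X, F (L.map σ.toEmbedding) =
      ((#L).factorial * (Fintype.card X - #L).factorial : ℝ) *
        ∑ S ∈ powersetCard #L (univ : Finset X), F S := by
  have hfib : ∀ S ∈ powersetCard #L (univ : Finset X),
      #{σ : Equiv.Perm X | L.map σ.toEmbedding = S} =
        #{σ : Equiv.Perm X | L.map σ.toEmbedding = L} := by
    intro S hS
    obtain ⟨τ, hτ⟩ : ∃ τ : Equiv.Perm X, L.map τ.toEmbedding = S := by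
      have hc : #L = #S := (mem_powersetCard.1 hS).2.symm
      let ε : {x // x ∈ L} ≃ {x // x ∈ S} := Finset.equivOfCardEq hc
      refine ⟨ε.extendSubtype, eq_of_subset_of_card_le ?_ (by simp [hc])⟩
      intro y hy
      obtain ⟨x, hx, rfl⟩ := mem_map.1 hy
      exact ε.extendSubtype_mem x hx
    refine card_equiv (Equiv.mulLeft τ⁻¹) fun σ => ?_
    simp only [mem_filter, mem_univ, true_and, Equiv.coe_mulLeft]
    have hσ : L.map σ.toEmbedding = (L.map (τ⁻¹ * σ).toEmbedding).map τ.toEmbedding := by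
      rw [Finset.map_map]
      congr 1
      ext x
      simp
    rw [← hτ, hσ, Finset.map_inj]
  have hmaps : ∀ σ ∈ (univ : Finset (Equiv.Perm X)),
      L.map σ.toEmbedding ∈ powersetCard #L (univ : Finset X) := by
    intro σ _
    simp [mem_powersetCard]
  have hsum : ∀ F : Finset X → ℝ, ∑ σ : Equiv.Perm X, F (L.map σ.toEmbedding) =
      (#{σ : Equiv.Perm X | L.map σ.toEmbedding = L} : ℝ) *
        ∑ S ∈ powersetCard #L (univ : Finset X), F S := by
    intro F
    rw [← sum_fiberwise_of_maps_to hmaps, mul_sum]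
    refine sum_congr rfl fun S hS => ?_
    rw [← hfib S hS, sum_congr rfl (g := fun _ => F S) fun σ hσ => by rw [(mem_filter.1 hσ).2]]
    simp
  rw [hsum]
  congr 1
  -- the fibre cardinality is found by counting all permutations
  have h1 := hsum fun _ => 1
  simp only [sum_const, card_univ, Fintype.card_perm, nsmul_eq_mul, mul_one, card_powersetCard]
    at h1
  have hle : #L ≤ Fintype.card X := card_le_univ L
  have h2 := Nat.choose_mul_factorial_mul_factorial hle
  rw [← h2] at h1
  have hpos : (0 : ℝ) < (Fintype.card X).choose #L := by exact_mod_cast Nat.choose_pos hle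
  push_cast at h1
  refine mul_right_cancel₀ hpos.ne' (h1.symm.trans ?_)
  ring

theorem card_filter_card_sdiff_eq (L : Finset X) {r : ℕ} (hr : r ≤ #L) :
    #{S ∈ powersetCard #L (univ : Finset X) | #(S \ L) = r} =
      (#L).choose r * (Fintype.card X - #L).choose r := by
  have h : (#L).choose r * (Fintype.card X - #L).choose r =
      #(powersetCard (#L - r) L ×ˢ powersetCard r (univ \ L)) := by
    rw [card_product, card_powersetCard, card_powersetCard, card_univ_sdiff, Nat.choose_symm hr]
  rw [h]
  refine card_bij' (fun S _ => (S ∩ L, S \ L)) (fun p _ => p.1 ∪ p.2) ?_ ?_ ?_ ?_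
  · intro S hS
    simp only [mem_filter, mem_powersetCard, subset_univ, true_and] at hS
    simp only [mem_product, mem_powersetCard, inter_subset_right, true_and]
    have := card_inter_add_card_sdiff S L
    exact ⟨by omega, sdiff_subset_sdiff (subset_univ _) subset_rfl, hS.2⟩
  · rintro ⟨A, B⟩ hAB
    simp only [mem_product, mem_powersetCard, subset_sdiff] at hAB
    obtain ⟨⟨hA, hAc⟩, ⟨-, hB⟩, hBc⟩ := hAB
    simp only [mem_filter, mem_powersetCard, subset_univ, true_and]
    have hd : Disjoint A B := (hB.mono_right hA).symm
    rw [card_union_of_disjoint hd, union_sdiff_distrib, sdiff_eq_empty_iff_subset.2 hA,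
      hB.sdiff_eq_left, empty_union]
    exact ⟨by omega, hBc⟩
  · intro S _
    exact (union_comm _ _).trans (sdiff_union_inter S L)
  · rintro ⟨A, B⟩ hAB
    simp only [mem_product, mem_powersetCard, subset_sdiff] at hAB
    obtain ⟨⟨hA, -⟩, ⟨-, hB⟩, -⟩ := hAB
    simp only [Prod.mk.injEq]
    rw [union_inter_distrib_right, inter_eq_left.2 hA, disjoint_iff_inter_eq_empty.1 hB,
      union_sdiff_distrib, sdiff_eq_empty_iff_subset.2 hA, hB.sdiff_eq_left]
    simp

theorem sum_perm_crossings (s : X → Bool) {n m : ℕ} (hn : #{x | s x = false} = n)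
    (hm : Fintype.card X = n + m) (F : ℕ → ℝ) :
    ∑ σ : Equiv.Perm X, F (crossings s σ) =
      ∑ r ∈ range (min n m + 1),
        (n.factorial * m.factorial * n.choose r * m.choose r : ℝ) * F r := by
  set L : Finset X := {x | s x = false} with hL
  have hcross : ∀ σ : Equiv.Perm X, crossings s σ = #(L.map σ.toEmbedding \ L) := by
    intro σ
    have : L.map σ.toEmbedding \ L = ({x | s x = false ∧ s (σ x) = true} : Finset X).map
        σ.toEmbedding := by
      ext y
      obtain ⟨x, rfl⟩ := σ.surjective y
      simp [hL]
    rw [this, card_map, crossings]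
  simp only [hcross]
  rw [sum_perm_map_eq L fun S => F #(S \ L), hn, hm, Nat.add_sub_cancel_left]
  have hmaps : ∀ S ∈ powersetCard n (univ : Finset X), #(S \ L) ∈ range (min n m + 1) := by
    intro S hS
    have hSc := (mem_powersetCard.1 hS).2
    have h1 : #(S \ L) ≤ #S := card_le_card sdiff_subset
    have h2 : #(S \ L) ≤ #(univ \ L) := card_le_card (sdiff_subset_sdiff (subset_univ _) subset_rfl)
    rw [card_univ_sdiff, hn, hm] at h2
    rw [mem_range]
    omega
  rw [← sum_fiberwise_of_maps_to hmaps, mul_sum]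
  refine sum_congr rfl fun r hr => ?_
  rw [sum_congr rfl (g := fun _ => F r) fun S hS => by rw [(mem_filter.1 hS).2]]
  have hrn : r ≤ #L := by
    rw [mem_range] at hr
    omega
  have hc := card_filter_card_sdiff_eq L hrn
  rw [hn, hm, Nat.add_sub_cancel_left] at hc
  rw [sum_const, hc, nsmul_eq_mul]
  push_cast
  ring

end Crossings

/-! ### Correlations of square-summable families under permutations of the indices -/

section Correlation

variable {ι K : Type*} {G : (K → ι) → ℝ}

/-- The correlation of a family `G`, indexed by functions `J : K → ι`, with the family obtained
from it by permuting the arguments of `J`. -/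
def corr (G : (K → ι) → ℝ) (π : Equiv.Perm K) : ℝ :=
  ∑' J : K → ι, G (J ∘ π) * G J

theorem hasSum_comp_perm_iff {F : (K → ι) → ℝ} {a : ℝ} (ρ : Equiv.Perm K) :
    HasSum (fun J => F (J ∘ ρ)) a ↔ HasSum F a :=
  (ρ.symm.arrowCongr (Equiv.refl ι)).hasSum_iff

theorem summable_comp_perm {F : (K → ι) → ℝ} (hF : Summable F) (ρ : Equiv.Perm K) :
    Summable fun J => F (J ∘ ρ) :=
  ((hasSum_comp_perm_iff ρ).2 hF.hasSum).summable

theorem summable_mul_of_summable_sq {κ : Type*} {x y : κ → ℝ} (hx : Summable fun k => x k ^ 2)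
    (hy : Summable fun k => y k ^ 2) : Summable fun k => x k * y k := by
  refine (hx.add hy).of_norm_bounded fun k => ?_
  rw [Real.norm_eq_abs, abs_le]
  constructor <;> nlinarith [sq_nonneg (x k + y k), sq_nonneg (x k - y k)]

/-- Products of two permuted copies of `G` only depend on the quotient of the permutations, after
summation. -/
theorem hasSum_corr (hG : Summable fun J => G J ^ 2) (π ρ : Equiv.Perm K) :
    HasSum (fun J => G (J ∘ π) * G (J ∘ ρ)) (corr G (ρ⁻¹ * π)) := by
  have h := (summable_mul_of_summable_sq (summable_comp_perm hG (ρ⁻¹ * π)) hG).hasSum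
  rw [← hasSum_comp_perm_iff ρ] at h
  refine h.congr_fun fun J => ?_
  have : (J ∘ ρ) ∘ (ρ⁻¹ * π : Equiv.Perm K) = J ∘ π := by
    funext x
    simp
  rw [this]

theorem corr_permCongr {K' : Type*} (Ψ : K' ≃ K) (π : Equiv.Perm K') :
    corr (fun J : K' → ι => G (J ∘ Ψ.symm)) π = corr G (Ψ.permCongr π) := by
  rw [corr, corr, ← (Ψ.arrowCongr (Equiv.refl ι)).tsum_eq]
  refine tsum_congr fun J => ?_
  congr 2
  funext x
  simp

/-- Antisymmetrizing a square-summable family in two distinguished indices and averaging it over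
the permutations of the others: by bilinearity and translation invariance of the sum over
permutations, one of the two averages can be dropped. -/
theorem hasSum_sq_sum_perm_antisymm {X : Type*} [Fintype X] [DecidableEq X]
    {G : (Bool ⊕ X → ι) → ℝ} (hG : Summable fun J => G J ^ 2) :
    HasSum (fun J => (∑ σ : Equiv.Perm X, (G (J ∘ Equiv.sumCongr 1 σ) -
        G (J ∘ Equiv.sumCongr Equiv.boolNot σ))) ^ 2)
      (2 * (Fintype.card X).factorial * ∑ σ : Equiv.Perm X,
        (corr G (Equiv.sumCongr 1 σ) - corr G (Equiv.sumCongr Equiv.boolNot σ))) := by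
  have hinv : ∀ (b c : Equiv.Perm Bool) (σ τ : Equiv.Perm X),
      (Equiv.sumCongr b τ : Equiv.Perm (Bool ⊕ X))⁻¹ * Equiv.sumCongr c σ =
        Equiv.sumCongr (b⁻¹ * c) (τ⁻¹ * σ) := by
    intro b c σ τ
    ext x
    rcases x with x | x <;> rfl
  have hb : Equiv.boolNot⁻¹ * Equiv.boolNot = (1 : Equiv.Perm Bool) := inv_mul_cancel _
  have hb' : Equiv.boolNot⁻¹ * 1 = Equiv.boolNot := by decide
  have hterm : ∀ τ σ : Equiv.Perm X, HasSum (fun J =>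
      (G (J ∘ Equiv.sumCongr 1 σ) - G (J ∘ Equiv.sumCongr Equiv.boolNot σ)) *
        (G (J ∘ Equiv.sumCongr 1 τ) - G (J ∘ Equiv.sumCongr Equiv.boolNot τ)))
      (2 * (corr G (Equiv.sumCongr 1 (τ⁻¹ * σ)) -
        corr G (Equiv.sumCongr Equiv.boolNot (τ⁻¹ * σ)))) := by
    intro τ σ
    have h := ((hasSum_corr hG (Equiv.sumCongr 1 σ) (Equiv.sumCongr 1 τ)).sub
        (hasSum_corr hG (Equiv.sumCongr Equiv.boolNot σ) (Equiv.sumCongr 1 τ))).add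
      ((hasSum_corr hG (Equiv.sumCongr Equiv.boolNot σ) (Equiv.sumCongr Equiv.boolNot τ)).sub
        (hasSum_corr hG (Equiv.sumCongr 1 σ) (Equiv.sumCongr Equiv.boolNot τ)))
    simp only [hinv, inv_one, one_mul, hb, hb'] at h
    rw [two_mul]
    refine h.congr_fun fun J => ?_
    ring
  have hval : ∑ τ : Equiv.Perm X, ∑ σ : Equiv.Perm X,
      (2 * (corr G (Equiv.sumCongr 1 (τ⁻¹ * σ)) -
        corr G (Equiv.sumCongr Equiv.boolNot (τ⁻¹ * σ)))) =
      2 * (Fintype.card X).factorial * ∑ σ : Equiv.Perm X,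
        (corr G (Equiv.sumCongr 1 σ) - corr G (Equiv.sumCongr Equiv.boolNot σ)) := by
    refine (Finset.sum_congr rfl fun τ _ => Equiv.sum_comp (Equiv.mulLeft τ⁻¹) fun σ =>
      2 * (corr G (Equiv.sumCongr 1 σ) - corr G (Equiv.sumCongr Equiv.boolNot σ))).trans ?_
    rw [Finset.sum_const, Finset.card_univ, Fintype.card_perm, nsmul_eq_mul, ← Finset.mul_sum]
    ring
  rw [← hval]
  refine (hasSum_sum fun τ (_ : τ ∈ Finset.univ) =>
    hasSum_sum fun σ (_ : σ ∈ Finset.univ) => hterm τ σ).congr_fun fun J => ?_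
  rw [pow_two, Finset.sum_mul_sum, Finset.sum_comm]

end Correlation

/-! ### Correlations of tensor products and norms of contractions -/

section TensorCorrelation

variable {ι : Type*}

/-- The tensor product of two families, as a family indexed by functions on the disjoint union of
the two sets of positions. -/
def tensorFamily {α β : Type*} (A : (α → ι) → ℝ) (B : (β → ι) → ℝ) (J : α ⊕ β → ι) : ℝ :=
  A (J ∘ Sum.inl) * B (J ∘ Sum.inr)

variable {α β : Type*} {A : (α → ι) → ℝ} {B : (β → ι) → ℝ}

theorem summable_tensorFamily_sq (hA : Summable fun j => A j ^ 2)
    (hB : Summable fun k => B k ^ 2) : Summable fun J => tensorFamily A B J ^ 2 := by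
  have h := hA.mul_of_nonneg hB (fun _ => sq_nonneg _) (fun _ => sq_nonneg _)
  rw [← (Equiv.sumArrowEquivProdArrow α β ι).summable_iff] at h
  refine (summable_congr fun J => ?_).2 h
  exact mul_pow _ _ _

theorem tensorFamily_comp_of_side_eq [Finite α] [Finite β]
    (hA : ∀ (σ : Equiv.Perm α) j, A (j ∘ σ) = A j) (hB : ∀ (σ : Equiv.Perm β) k, B (k ∘ σ) = B k)
    {ρ : Equiv.Perm (α ⊕ β)} (hρ : ∀ x, (ρ x).isRight = x.isRight) (J : α ⊕ β → ι) :
    tensorFamily A B (J ∘ ρ) = tensorFamily A B J := by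
  have hmem : ρ ∈ (Equiv.Perm.sumCongrHom α β).range := by
    refine Equiv.Perm.mem_sumCongrHom_range_of_perm_mapsTo_inl ?_
    rintro _ ⟨a, rfl⟩
    have h := hρ (Sum.inl a)
    rcases hx : ρ (Sum.inl a) with b | b
    · exact ⟨b, rfl⟩
    · simp [hx] at h
  obtain ⟨⟨σ, τ⟩, rfl⟩ := hmem
  exact congrArg₂ (· * ·) (hA σ (J ∘ Sum.inl)) (hB τ (J ∘ Sum.inr))

/-- For symmetric factors, the correlation is constant on double cosets of the group of permutations
preserving the two blocks, hence is a function of the crossing number. -/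
theorem corr_tensorFamily_eq_of_crossings_eq [Fintype α] [Fintype β]
    (hA : ∀ (σ : Equiv.Perm α) j, A (j ∘ σ) = A j) (hB : ∀ (σ : Equiv.Perm β) k, B (k ∘ σ) = B k)
    {π π' : Equiv.Perm (α ⊕ β)} (h : crossings Sum.isRight π = crossings Sum.isRight π') :
    corr (tensorFamily A B) π = corr (tensorFamily A B) π' := by
  obtain ⟨ρ, δ, hρ, hδ, rfl⟩ := exists_perm_of_crossings_eq _ h
  have hρ' : ∀ x, (ρ⁻¹ x).isRight = x.isRight := by
    intro x
    simpa using (hρ (ρ⁻¹ x)).symm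
  rw [corr, corr, ← (δ.symm.arrowCongr (Equiv.refl ι)).tsum_eq]
  refine tsum_congr fun J => ?_
  exact congrArg₂ (· * ·)
    (tensorFamily_comp_of_side_eq hA hB hρ' (J ∘ (δ * π : Equiv.Perm (α ⊕ β)))).symm
    (tensorFamily_comp_of_side_eq hA hB hδ J)

theorem glue_surjective {n r : ℕ} (hr : r ≤ n) :
    Function.Surjective fun p : (Fin r → ι) × (Fin (n - r) → ι) => glue p.1 p.2 := by
  intro J
  refine ⟨(fun a => J ⟨a, by omega⟩, fun a => J ⟨a + r, by omega⟩), ?_⟩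
  funext a
  by_cases h : (a : ℕ) < r
  · simp [glue, h]
  · simp only [glue, h, dite_false]
    congr 1
    ext
    simp only
    omega

/-- The involution of the disjoint union of `n` and `m` positions which exchanges the first `r`
positions of the two blocks. -/
def swapFirst {n m r : ℕ} (hn : r ≤ n) (hm : r ≤ m) : Equiv.Perm (Fin n ⊕ Fin m) :=
  Function.Involutive.toPerm
    (Sum.elim
      (fun p => if h : (p : ℕ) < r then Sum.inr ⟨p, h.trans_le hm⟩ else Sum.inl p)
      (fun q => if h : (q : ℕ) < r then Sum.inl ⟨q, h.trans_le hn⟩ else Sum.inr q))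
    (by
      rintro (p | p) <;> by_cases h : (p : ℕ) < r <;> simp [h])

theorem swapFirst_inl {n m r : ℕ} (hn : r ≤ n) (hm : r ≤ m) (p : Fin n) :
    swapFirst hn hm (Sum.inl p) =
      if h : (p : ℕ) < r then Sum.inr ⟨p, h.trans_le hm⟩ else Sum.inl p :=
  rfl

theorem swapFirst_inr {n m r : ℕ} (hn : r ≤ n) (hm : r ≤ m) (q : Fin m) :
    swapFirst hn hm (Sum.inr q) =
      if h : (q : ℕ) < r then Sum.inl ⟨q, h.trans_le hn⟩ else Sum.inr q :=
  rfl

theorem crossings_swapFirst {n m r : ℕ} (hn : r ≤ n) (hm : r ≤ m) :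
    crossings Sum.isRight (swapFirst hn hm) = r := by
  have h : ∀ p : Fin n, (swapFirst hn hm (Sum.inl p)).isRight = true ↔ (p : ℕ) < r := by
    intro p
    by_cases h : (p : ℕ) < r <;> simp [swapFirst_inl, h]
  simp only [crossings, Finset.card_filter, Fintype.sum_sum_type, h]
  simp only [Sum.isRight_inl, Sum.isRight_inr, true_and, Bool.true_eq_false, false_and, if_false,
    Finset.sum_const_zero, add_zero]
  rw [← Finset.card_filter, Fin.card_filter_val_lt, min_eq_right hn]

/-- Exchanging the first `r` positions of the two blocks pairs the two copies of each factor as in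
the square of the norm of the contraction of order `r`. -/
theorem hasSum_contraction_sq {n m r : ℕ} (hn : r ≤ n) (hm : r ≤ m) {A : (Fin n → ι) → ℝ}
    {B : (Fin m → ι) → ℝ} (hA : Summable fun j => A j ^ 2) (hB : Summable fun k => B k ^ 2) :
    HasSum (fun p : (Fin (n - r) → ι) × (Fin (m - r) → ι) =>
      (∑' i : Fin r → ι, A (glue i p.1) * B (glue i p.2)) ^ 2)
      (corr (tensorFamily A B) (swapFirst hn hm)) := by
  let en : (Fin r → ι) × (Fin (n - r) → ι) ≃ (Fin n → ι) :=
    Equiv.ofBijective _ ⟨glue_injective hn, glue_surjective hn⟩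
  let em : (Fin r → ι) × (Fin (m - r) → ι) ≃ (Fin m → ι) :=
    Equiv.ofBijective _ ⟨glue_injective hm, glue_surjective hm⟩
  -- the indices of the contraction square: the free indices of both factors, and two copies of the
  -- contracted indices, one for each block
  let Φ : ((Fin (n - r) → ι) × (Fin (m - r) → ι)) × ((Fin r → ι) × (Fin r → ι)) ≃
      (Fin n ⊕ Fin m → ι) :=
    ((Equiv.prodComm _ _).trans (Equiv.prodProdProdComm _ _ _ _)).trans
      ((Equiv.prodCongr en em).trans (Equiv.sumArrowEquivProdArrow _ _ _).symm)
  have hinl : ∀ q, Φ q ∘ Sum.inl = glue q.2.1 q.1.1 := fun _ => rfl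
  have hinr : ∀ q, Φ q ∘ Sum.inr = glue q.2.2 q.1.2 := fun _ => rfl
  have hswapl : ∀ q, (Φ q ∘ swapFirst hn hm) ∘ Sum.inl = glue q.2.2 q.1.1 := by
    intro q
    funext p
    have h1 := congrFun (hinl q)
    have h2 := congrFun (hinr q)
    simp only [Function.comp_apply] at h1 h2 ⊢
    by_cases h : (p : ℕ) < r <;> simp [swapFirst_inl, h, h1, h2, glue]
  have hswapr : ∀ q, (Φ q ∘ swapFirst hn hm) ∘ Sum.inr = glue q.2.1 q.1.2 := by
    intro q
    funext p
    have h1 := congrFun (hinl q)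
    have h2 := congrFun (hinr q)
    simp only [Function.comp_apply] at h1 h2 ⊢
    by_cases h : (p : ℕ) < r <;> simp [swapFirst_inr, h, h1, h2, glue]
  have hall : HasSum (fun q : ((Fin (n - r) → ι) × (Fin (m - r) → ι)) ×
      ((Fin r → ι) × (Fin r → ι)) =>
      (A (glue q.2.1 q.1.1) * B (glue q.2.1 q.1.2)) *
        (A (glue q.2.2 q.1.1) * B (glue q.2.2 q.1.2)))
      (corr (tensorFamily A B) (swapFirst hn hm)) := by
    have h := (summable_mul_of_summable_sq
      (summable_comp_perm (summable_tensorFamily_sq hA hB) (swapFirst hn hm))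
      (summable_tensorFamily_sq hA hB)).hasSum
    rw [← Φ.hasSum_iff] at h
    refine h.congr_fun fun q => ?_
    simp only [Function.comp_apply, tensorFamily, hinl, hinr, hswapl, hswapr]
    ring
  refine hall.prod_fiberwise fun p => ?_
  have hAp : Summable fun i : Fin r → ι => A (glue i p.1) ^ 2 :=
    hA.comp_injective fun i i' h =>
      congrArg Prod.fst (glue_injective hn (a₁ := (i, p.1)) (a₂ := (i', p.1)) h)
  have hBp : Summable fun i : Fin r → ι => B (glue i p.2) ^ 2 :=
    hB.comp_injective fun i i' h =>
      congrArg Prod.fst (glue_injective hm (a₁ := (i, p.2)) (a₂ := (i', p.2)) h)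
  have hs := (summable_mul_of_summable_sq hAp hBp).hasSum
  rw [pow_two]
  exact hs.mul hs (hall.summable.prod_factor p)

theorem norm_contraction_sq_eq_corr {H : Type*} [NormedAddCommGroup H] [InnerProductSpace ℝ H]
    (e : HilbertBasis ι ℝ H) {n m : ℕ} {f : TensorPow H n} {g : TensorPow H m}
    (hf : IsSymmetric e f) (hg : IsSymmetric e g) (π : Equiv.Perm (Fin n ⊕ Fin m)) :
    corr (tensorFamily (coeff e f) (coeff e g)) π =
      ‖contraction e (crossings Sum.isRight π) f g‖ ^ 2 := by
  have hn : crossings Sum.isRight π ≤ n :=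
    (crossings_le_card_left _ _).trans_eq (by
      rw [Finset.card_filter, Fintype.sum_sum_type]
      simp)
  have hm : crossings Sum.isRight π ≤ m :=
    (crossings_le_card_right _ _).trans_eq (by
      rw [Finset.card_filter, Fintype.sum_sum_type]
      simp)
  have h := hasSum_contraction_sq hn hm (summable_coeff_sq e f) (summable_coeff_sq e g)
  rw [corr_tensorFamily_eq_of_crossings_eq hf hg (crossings_swapFirst hn hm).symm]
  exact h.unique (hasSum_norm_contraction_sq e f g h.summable)

end TensorCorrelation

/-! ### The term of order zero -/

section ChaosTerm

/-- The two distinguished positions `false` and `true`, followed by two blocks of `n` and `m`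
positions, rearranged into two blocks of `n + 1` and `m + 1` positions starting with the
distinguished ones. -/
def headsEquiv (n m : ℕ) : Bool ⊕ Fin (n + m) ≃ Fin (n + 1) ⊕ Fin (m + 1) where
  toFun := Sum.elim (fun b => cond b (Sum.inr 0) (Sum.inl 0))
    (Fin.addCases (fun p => Sum.inl p.succ) (fun q => Sum.inr q.succ))
  invFun := Sum.elim
    (Fin.cases (Sum.inl false) fun p => Sum.inr (Fin.castAdd m p))
    (Fin.cases (Sum.inl true) fun q => Sum.inr (Fin.natAdd n q))
  left_inv := by
    rintro (b | p)
    · cases b <;> rfl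
    · refine Fin.addCases (fun p => ?_) (fun q => ?_) p <;> simp
  right_inv := by
    rintro (p | q)
    · refine Fin.cases ?_ (fun p => ?_) p <;> simp
    · refine Fin.cases ?_ (fun q => ?_) q <;> simp

variable {ι : Type*} {n m : ℕ}

theorem tensorFamily_comp_headsEquiv_symm (A : (Fin (n + 1) → ι) → ℝ)
    (B : (Fin (m + 1) → ι) → ℝ) (J : Bool ⊕ Fin (n + m) → ι) :
    tensorFamily A B (J ∘ (headsEquiv n m).symm) =
      A (Fin.cons (J (Sum.inl false)) ((J ∘ Sum.inr) ∘ Fin.castAdd m)) *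
        B (Fin.cons (J (Sum.inl true)) ((J ∘ Sum.inr) ∘ Fin.natAdd n)) := by
  rw [tensorFamily]
  congr 2 <;> funext p <;> refine Fin.cases ?_ (fun p => ?_) p <;> rfl

/-- Keeping the distinguished positions fixed does not change the crossing number, exchanging
them adds one crossing. -/
theorem crossings_headsEquiv (τ : Equiv.Perm Bool) (σ : Equiv.Perm (Fin (n + m))) :
    crossings Sum.isRight ((headsEquiv n m).permCongr (Equiv.sumCongr τ σ)) =
      crossings id τ + crossings (fun p => (headsEquiv n m (Sum.inr p)).isRight) σ := by
  rw [crossings_permCongr, crossings_sumCongr]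
  congr 2
  funext b
  cases b <;> rfl

theorem card_left_headsEquiv : (Finset.univ.filter fun p : Fin (n + m) =>
    (headsEquiv n m (Sum.inr p)).isRight = false).card = n := by
  rw [Finset.card_filter, Fin.sum_univ_add]
  simp [headsEquiv]

variable {H : Type*} [NormedAddCommGroup H] [InnerProductSpace ℝ H] (e : HilbertBasis ι ℝ H)

/-- The factor `2` is cancelled by the `1 / 2` in `chaosTerm`. -/
theorem hasSum_chaosSummand {f : TensorPow H (n + 1)} {g : TensorPow H (m + 1)}
    (hf : IsSymmetric e f) (hg : IsSymmetric e g) :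
    HasSum (fun p : ι × ι => chaosSummand e f g 0 p.1 p.2)
      (2 * (((m + 1 : ℕ) : ℝ) * (n + 1 : ℕ) * (m + 1).factorial * (n + 1).factorial *
        ∑ r ∈ Finset.range (min n m + 1), (n.choose r : ℝ) * m.choose r *
          (‖contraction e r f g‖ ^ 2 - ‖contraction e (r + 1) f g‖ ^ 2))) := by
  set T := tensorFamily (coeff e f) (coeff e g) with hT
  set G : (Bool ⊕ Fin (n + m) → ι) → ℝ := fun J => T (J ∘ (headsEquiv n m).symm) with hG
  have hsq : Summable fun J => G J ^ 2 := by
    have h := summable_tensorFamily_sq (summable_coeff_sq e f) (summable_coeff_sq e g)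
    rw [← ((headsEquiv n m).arrowCongr (Equiv.refl ι)).summable_iff] at h
    exact h
  set F : ℕ → ℝ := fun r => ‖contraction e r f g‖ ^ 2 with hF
  set s : Fin (n + m) → Bool := fun p => (headsEquiv n m (Sum.inr p)).isRight
  have hcorr : ∀ τ σ, corr G (Equiv.sumCongr τ σ) = F (crossings id τ + crossings s σ) := by
    intro τ σ
    rw [hG, corr_permCongr, hT, norm_contraction_sq_eq_corr e hf hg, crossings_headsEquiv]
  have h1 : crossings id (1 : Equiv.Perm Bool) = 0 := by decide
  have h2 : crossings id Equiv.boolNot = 1 := by decide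
  have hmain := (hasSum_sq_sum_perm_antisymm hsq).mul_left
    (((n + 1 : ℝ) * (m + 1)) ^ 2 * ((n + m).factorial : ℝ)⁻¹)
  simp only [hcorr, h1, h2, zero_add, Fintype.card_fin] at hmain
  rw [sum_perm_crossings s card_left_headsEquiv (Fintype.card_fin _)
    fun r => F r - F (1 + r)] at hmain
  let Φ : (ι × ι) × (Fin (n + m) → ι) ≃ (Bool ⊕ Fin (n + m) → ι) :=
    (Equiv.prodCongr (Equiv.boolArrowEquivProd ι).symm (Equiv.refl _)).trans
      (Equiv.sumArrowEquivProdArrow _ _ _).symm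
  rw [← Φ.hasSum_iff] at hmain
  -- summing the inner indices first gives back the summands for the pairs `(i, l)`
  have hfib := hmain.prod_fiberwise (g := fun p : ι × ι => chaosSummand e f g 0 p.1 p.2) (by
    rintro ⟨i, l⟩
    refine (hasSum_chaosSummand_zero e f g i l).congr_fun fun j => ?_
    simp only [hG, hT, Function.comp_apply, tensorFamily_comp_headsEquiv_symm]
    rfl)
  refine Eq.subst (motive := fun x => HasSum _ x) ?_ hfib
  have hN : ((n + m).factorial : ℝ) ≠ 0 := by positivity
  simp only [hF, Finset.mul_sum]
  refine Finset.sum_congr rfl fun r _ => ?_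
  rw [Nat.factorial_succ, Nat.factorial_succ, add_comm 1 r]
  push_cast
  field_simp

end ChaosTerm

end WienerChaos

end

theorem proposition5 {H : Type*} [NormedAddCommGroup H] [InnerProductSpace ℝ H]
    [CompleteSpace H] [TopologicalSpace.SeparableSpace H]
    {ι : Type*} (e : HilbertBasis ι ℝ H) {n m : ℕ} (hn : 1 ≤ n) (hm : 1 ≤ m)
    (f : WienerChaos.TensorPow H n) (g : WienerChaos.TensorPow H m)
    (hf : WienerChaos.IsSymmetric e f) (hg : WienerChaos.IsSymmetric e g) :
    Summable (fun p : ι × ι => WienerChaos.chaosSummand e f g 0 p.1 p.2) ∧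
    WienerChaos.chaosTerm e f g 0 =
      ∑ r ∈ Finset.range (min (n - 1) (m - 1) + 1),
        (m : ℝ) * n * m.factorial * n.factorial * (n - 1).choose r * (m - 1).choose r *
          (‖WienerChaos.contraction e r f g‖ ^ 2 -
            ‖WienerChaos.contraction e (r + 1) f g‖ ^ 2) ∧
    0 ≤ ∑ r ∈ Finset.range (min (n - 1) (m - 1) + 1),
        ((n - 1).choose r : ℝ) * (m - 1).choose r *
          (‖WienerChaos.contraction e r f g‖ ^ 2 -
            ‖WienerChaos.contraction e (r + 1) f g‖ ^ 2) := by
  obtain ⟨n, rfl⟩ := Nat.exists_eq_add_of_le' hn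
  obtain ⟨m, rfl⟩ := Nat.exists_eq_add_of_le' hm
  simp only [Nat.add_sub_cancel]
  have h := WienerChaos.hasSum_chaosSummand e hf hg
  have hT : WienerChaos.chaosTerm e f g 0 =
      ((m + 1 : ℕ) : ℝ) * (n + 1 : ℕ) * (m + 1).factorial * (n + 1).factorial *
        ∑ r ∈ Finset.range (min n m + 1), (n.choose r : ℝ) * m.choose r *
          (‖WienerChaos.contraction e r f g‖ ^ 2 -
            ‖WienerChaos.contraction e (r + 1) f g‖ ^ 2) := by
    rw [WienerChaos.chaosTerm, h.tsum_eq, one_div, inv_mul_cancel_left₀ two_ne_zero]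
  refine ⟨h.summable, ?_, ?_⟩
  · rw [hT, Finset.mul_sum]
    exact Finset.sum_congr rfl fun r _ => by ring
  · have hpos : 0 ≤ WienerChaos.chaosTerm e f g 0 :=
      mul_nonneg (by norm_num) (tsum_nonneg fun p => by
        rw [WienerChaos.chaosSummand]
        positivity)
    rw [hT] at hpos
    exact nonneg_of_mul_nonneg_right hpos (by positivity)
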